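/- Let $\mathcal X,\mathcal U,\mathcal Y$ be finite sets with $\mathcal U\neq\emptyset$ (states, controls, measurements), let $\pi_0$ be a pmf on $\mathcal X$, let $A^{x,\bar x}(u)$ be transition probabilities (from $\bar x$ to $x$ under $u$) and $B^x(y,u)$ measurement probabilities, let $c:\mathcal X\times\mathcal X\times\mathcal U\to\mathbb R$, $\psi:\Delta(\mathcal X\times\mathcal X)\times\mathcal U\to\mathbb R$ and $\gamma\in(0,1)$. The initial-state cost POMDP (ISC-POMDP) is the problem $$\inf_{\mu\in\mathcal P}E_\mu\Big[\sum_{k=0}^\infty\gamma^k\big(c(X_0,X_k,U_k)+\psi(\xi_k,U_k)\big)\Big],$$ where $\mathcal P$ is the set of deterministic policies $U_k=\mu(Y^k,U^{k-1})$ with $Y^k=(Y_1,\dots,Y_k)$ and $U^{k-1}=(U_0,\dots,U_{k-1})$, where under the law $P_\mu$ one has $X_0\sim\pi_0$, $X_{k+1}\mid X_k,U_k\sim A^{\cdot,X_k}(U_k)$, $Y_{k+1}\mid X_{k+1},U_k\sim B^{X_{k+1}}(\cdot,U_k)$, and where $\xi_k(x_0,x)=P_\mu(X_0=x_0,X_k=x\mid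 Y^k,U^{k-1})$. Let $\mathcal L:\mathcal X\times\mathcal X\to\mathcal S$ be a bijection (for example $\mathcal S=\mathcal X\times\mathcal X$ and the identity), and put $S_k=\mathcal L(X_0,X_k)$; via $\mathcal L$ regard $\xi_k$ as an element of $\Delta(\mathcal S)$ and $c$ as a function on $\mathcal S\times\mathcal U$, $c(\mathcal L(x_0,x),u)=c(x_0,x,u)$. Let $\overline\xi_0(\mathcal L(x_0,x))=\pi_0(x)$ if $x_0=x$ and $0$ otherwise; $\overline A^{s,\bar s}(u)=A^{x,\bar x}(u)$ if $s=\mathcal L(x_0,x)$ and $\bar s=\mathcal L(x_0,\bar x)$ for some $x_0$, and $0$ otherwise; $\overline B^{s}(y,u)=B^x(y,u)$ for $s=\mathcal L(x_0,x)$. For $\xi\in\Delta(\mathcal S)$ put $$\overline C(\xi,u)=\sum_{s}\xi(s)c(s,u),\qquad p(y\mid\xi,u)=\sum_{\bar s,\tilde s}\overline B^{\tilde s}(y,u)\overline A^{\tilde s,\bar s}(u)\xi(\bar s),\qquad \Xi(\xi,u,y)(s)=\frac{\overline B^{s}(y,u)\sum_{\bar s}\overline A^{s,\bar s}(u)\xi(\bar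 s)}{p(y\mid\xi,u)} .$$ The augmented-state POMDP is the problem $$\inf_{\overline\mu:\Delta(\mathcal S)\to\mathcal U}E_{\overline\mu}\Big[\sum_{k=0}^\infty\gamma^k\,\overline C(\xi_k,U_k)\Big],\qquad U_k=\overline\mu(\xi_k),\quad Y_{k+1}\mid\xi_k,U_k\sim p(\cdot\mid\xi_k,U_k),\quad \xi_{k+1}=\Xi(\xi_k,U_k,Y_{k+1}),\quad \xi_0=\overline\xi_0 ,$$ over stationary deterministic belief policies $\overline\mu$. If $\psi\equiv0$, then the ISC-POMDP is equivalent to the augmented-state POMDP, in the following sense. 1. For every $\mu\in\mathcal P$: $S_0$ has pmf $\overline\xi_0$, and, conditionally on events of positive probability, $P_\mu(S_{k+1}=s\mid S_k=\bar s,U_k=u)=\overline A^{s,\bar s}(u)$ and $P_\mu(Y_{k+1}=y\mid S_{k+1}=s,U_k=u)=\overline B^s(y,u)$. 2. For every $\mu\in\mathcal P$: $P_\mu$-almost surely, the posterior $\xi_k$ is for all $k\ge0$ the belief obtained from $\overline\xi_0$ by the recursion $\xi_{k+1}=\Xi(\xi_k,U_k,Y_{k+1})$, and, conditionally on events $\{Y^k=y^k,\,U^{k-1}=u^{k-1},\,U_k=u\}$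 of positive probability, $Y_{k+1}$ has pmf $p(\cdot\mid\xi_k,u)$. 3. The discounted costs in both problems converge along every trajectory and are integrable, and for every $\mu\in\mathcal P$ the ISC-POMDP cost of $\mu$ equals $E_\mu[\sum_k\gamma^k\overline C(\xi_k,U_k)]$. 4. For every belief policy $\overline\mu$, the policy $U_k=\overline\mu(\xi_k)$, where $\xi_k$ is computed from $(Y^k,U^{k-1})$ by the recursion, is in $\mathcal P$; it gives the measurements and controls the same law in the ISC-POMDP as $\overline\mu$ does in the augmented-state POMDP, and it has the same cost. 5. The two problems have the same optimal value; an optimal belief policy exists for the augmented-state POMDP; and a belief policy is optimal for the augmented-state POMDP if and only if the policy it induces as in 4. is optimal for the ISC-POMDP among all policies in $\mathcal P$. -/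

import Mathlib

open MeasureTheory ProbabilityTheory
open scoped ENNReal

noncomputable section

/-! ### Trajectory spaces -/

/-- What is observed at time `k`: nothing at time `0`, an element of `Y` at each time `k ≥ 1`. -/
def Obs (Y : Type*) : ℕ → Type _
  | 0 => PUnit
  | _ + 1 => Y

/-- The observable part of stage `k`: the measurement `Y_k` (absent for `k = 0`) and the
control `U_k`. -/
def Record (Y U : Type*) (k : ℕ) : Type _ := Obs Y k × U

/-- Stage `k` of a controlled process: the state `X_k` together with the record `(Y_k, U_k)`. -/
def Stage (X Y U : Type*) (k : ℕ) : Type _ := X × Record Y U k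

section Instances

variable {X Y U : Type*}

instance [Countable Y] (k : ℕ) : Countable (Obs Y k) := by
  cases k with
  | zero => exact inferInstanceAs (Countable PUnit)
  | succ k => exact inferInstanceAs (Countable Y)

instance [Countable Y] [Countable U] (k : ℕ) : Countable (Record Y U k) :=
  inferInstanceAs (Countable (Obs Y k × U))

instance [Countable X] [Countable Y] [Countable U] (k : ℕ) : Countable (Stage X Y U k) :=
  inferInstanceAs (Countable (X × Record Y U k))

instance (k : ℕ) : MeasurableSpace (Record Y U k) := ⊤

instance (k : ℕ) : DiscreteMeasurableSpace (Record Y U k) := ⟨fun _ => trivial⟩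

instance (k : ℕ) : MeasurableSpace (Stage X Y U k) := ⊤

instance (k : ℕ) : DiscreteMeasurableSpace (Stage X Y U k) := ⟨fun _ => trivial⟩

end Instances

section ProcessLaw

variable {E : ℕ → Type*} [∀ n, MeasurableSpace (E n)] [∀ n, DiscreteMeasurableSpace (E n)]
  [∀ n, Countable (E n)]

/-- A family of conditional pmfs, seen as a kernel. -/
def stepKernel (step : ∀ n, (∀ i : Finset.Iic n, E i) → PMF (E (n + 1))) (n : ℕ) :
    Kernel (∀ i : Finset.Iic n, E i) (E (n + 1)) :=
  Kernel.ofFunOfCountable fun h => (step n h).toMeasure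

instance (step : ∀ n, (∀ i : Finset.Iic n, E i) → PMF (E (n + 1))) (n : ℕ) :
    IsMarkovKernel (stepKernel step n) :=
  ⟨fun h => inferInstanceAs (IsProbabilityMeasure (step n h).toMeasure)⟩

/-- The law on trajectories `(z_0, z_1, …)` of the process with `z_0 ∼ p₀` and
`z_{n+1} ∼ step n (z_0, …, z_n)` (Ionescu-Tulcea). -/
def processLaw (p₀ : PMF (E 0)) (step : ∀ n, (∀ i : Finset.Iic n, E i) → PMF (E (n + 1))) :
    Measure (∀ n, E n) :=
  Kernel.trajMeasure p₀.toMeasure (stepKernel step)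

instance (p₀ : PMF (E 0)) (step : ∀ n, (∀ i : Finset.Iic n, E i) → PMF (E (n + 1))) :
    IsProbabilityMeasure (processLaw p₀ step) :=
  inferInstanceAs (IsProbabilityMeasure (Kernel.trajMeasure p₀.toMeasure (stepKernel step)))

end ProcessLaw

/-- A deterministic history-dependent policy `U_k = μ (Y^k, U^{k-1})`, with
`Y^k = (Y_1, …, Y_k)` and `U^{k-1} = (U_0, …, U_{k-1})`. -/
abbrev HistoryPolicy (Y U : Type*) : Type _ := ∀ k : ℕ, (Fin k → Y) → (Fin k → U) → U

/-- `(y_1, …, y_n)`, read off the records of the stages `0, …, n`. -/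
def pastObs {Y U : Type*} {n : ℕ} (h : ∀ i : Finset.Iic n, Record Y U i) : Fin n → Y :=
  fun j => (h ⟨(j : ℕ) + 1, Finset.mem_Iic.2 j.isLt⟩).1

/-- `(u_0, …, u_n)`, read off the records of the stages `0, …, n`. -/
def pastCtrl {Y U : Type*} {n : ℕ} (h : ∀ i : Finset.Iic n, Record Y U i) : Fin (n + 1) → U :=
  fun j => (h ⟨(j : ℕ), Finset.mem_Iic.2 (Nat.le_of_lt_succ j.isLt)⟩).2

/-- The control `U_k` of a sequence of records. -/
def ctrlAt {Y U : Type*} (r : ∀ k, Record Y U k) (k : ℕ) : U := (r k).2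

/-- The measurement `Y_{k+1}` of a sequence of records. -/
def obsSucc {Y U : Type*} (r : ∀ k, Record Y U k) (k : ℕ) : Y := (r (k + 1)).1

/-- `Y^k = (Y_1, …, Y_k)`. -/
def obsHist {Y U : Type*} (r : ∀ k, Record Y U k) (k : ℕ) : Fin k → Y := fun j => obsSucc r j

/-- `U^{k-1} = (U_0, …, U_{k-1})`. -/
def ctrlHist {Y U : Type*} (r : ∀ k, Record Y U k) (k : ℕ) : Fin k → U := fun j => ctrlAt r j

/-! ### Standard POMDPs, formulated as belief MDPs -/

/-- The data of a standard infinite-horizon discounted POMDP with states `S`, controls `U` and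
measurements `Y`. -/
structure POMDP (S U Y : Type*) where
  /-- pmf of the initial state -/
  init : PMF S
  /-- `trans u s̄ s` is the probability of moving from `s̄` to `s` under the control `u` -/
  trans : U → S → PMF S
  /-- `obs u s y` is the probability of measuring `y` in the new state `s` after the control `u` -/
  obs : U → S → PMF Y
  /-- cost of the current state and control -/
  cost : S → U → ℝ
  /-- discount factor -/
  γ : ℝ
  γ_pos : 0 < γ
  γ_lt_one : γ < 1

namespace POMDP

variable {S U Y : Type*} [Fintype S] (Q : POMDP S U Y)

/-- The conditional pmf `p(y | ξ, u)` of the next measurement given the belief and the control. -/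
def obsLaw (ξ : PMF S) (u : U) : PMF Y := (ξ.bind (Q.trans u)).bind (Q.obs u)

/-- The numerator of the Bayesian filter. -/
def filterNum (ξ : PMF S) (u : U) (y : Y) (s : S) : ℝ≥0∞ :=
  Q.obs u s y * ∑ s' : S, Q.trans u s' s * ξ s'

theorem tsum_filterNum_ne_top (ξ : PMF S) (u : U) (y : Y) :
    ∑' s, Q.filterNum ξ u y s ≠ ∞ := by
  rw [tsum_fintype]
  refine ENNReal.sum_ne_top.2 fun s _ => ENNReal.mul_ne_top (PMF.apply_ne_top _ _) ?_
  exact ENNReal.sum_ne_top.2 fun s' _ =>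
    ENNReal.mul_ne_top (PMF.apply_ne_top _ _) (PMF.apply_ne_top _ _)

open Classical in
/-- The Bayesian filter `ξ_{k+1} = Ξ(ξ_k, u_k, y_{k+1})`. If the measurement `y` has probability
zero given `(ξ, u)`, the belief is left unchanged, by convention. -/
def filter (ξ : PMF S) (u : U) (y : Y) : PMF S :=
  if h : ∑' s, Q.filterNum ξ u y s ≠ 0 then
    PMF.normalize (Q.filterNum ξ u y) h (Q.tsum_filterNum_ne_top ξ u y)
  else ξ

/-- The belief after the measurements `y_1, …, y_k` and the controls `u_0, …, u_{k-1}`. -/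
def belief : ∀ k : ℕ, (Fin k → Y) → (Fin k → U) → PMF S
  | 0, _, _ => Q.init
  | k + 1, y, u =>
    Q.filter (belief k (fun j => y j.castSucc) fun j => u j.castSucc)
      (u (Fin.last k)) (y (Fin.last k))

/-- The linear belief cost `C(ξ, u) = ∑ s, ξ(s) c(s, u)`. -/
def beliefCost (ξ : PMF S) (u : U) : ℝ := ∑ s : S, (ξ s).toReal * Q.cost s u

/-- Stationary deterministic belief policies `Δ(S) → U`. -/
abbrev BeliefPolicy (_Q : POMDP S U Y) : Type _ := PMF S → U

/-- The belief policy `m`, seen as a policy that depends on measurements and controls: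
`U_k = m (ξ_k)`. -/
def toHistoryPolicy (m : Q.BeliefPolicy) : HistoryPolicy Y U := fun k y u => m (Q.belief k y u)

variable [Countable Y] [Countable U]

/-- The law of the records `(U_0, Y_1, U_1, Y_2, …)` of the belief MDP under the belief policy `m`:
`U_k = m (ξ_k)`, `Y_{k+1} | ξ_k, U_k ∼ p(y | ξ_k, U_k)`, `ξ_{k+1} = Ξ(ξ_k, U_k, Y_{k+1})`. -/
def law (m : Q.BeliefPolicy) : Measure (∀ k, Record Y U k) :=
  processLaw (E := Record Y U) (PMF.pure (PUnit.unit, m Q.init)) fun n h =>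
    let y : Fin n → Y := pastObs h
    let u : Fin (n + 1) → U := pastCtrl h
    let ξ : PMF S := Q.belief n y fun j => u j.castSucc
    (Q.obsLaw ξ (u (Fin.last n))).map fun y' => (y', m (Q.filter ξ (u (Fin.last n)) y'))

/-- The belief process `ξ_k` along a sequence of records. -/
def beliefAt (r : ∀ k, Record Y U k) (k : ℕ) : PMF S := Q.belief k (obsHist r k) (ctrlHist r k)

/-- The `k`-th term `γ^k C(ξ_k, U_k)` of the discounted cost. -/
def costTerm (r : ∀ k, Record Y U k) (k : ℕ) : ℝ :=
  Q.γ ^ k * Q.beliefCost (Q.beliefAt r k) (ctrlAt r k)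

/-- `E_m [∑_k γ^k C(ξ_k, U_k)]`. -/
def expectedCost (m : Q.BeliefPolicy) : ℝ := ∫ r, ∑' k, Q.costTerm r k ∂(Q.law m)

/-- The optimal value of the POMDP. -/
def value : ℝ := ⨅ m : Q.BeliefPolicy, Q.expectedCost m

/-- The belief policy `m` solves the POMDP. -/
def IsOptimal (m : Q.BeliefPolicy) : Prop :=
  ∀ m' : Q.BeliefPolicy, Q.expectedCost m ≤ Q.expectedCost m'

end POMDP

/-! ### Initial-state cost POMDPs -/

/-- The data of an ISC-POMDP with states `X`, controls `U` and measurements `Y`. -/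
structure ISCPOMDP (X U Y : Type*) where
  /-- pmf of the initial state -/
  init : PMF X
  /-- `trans u x̄ x` is the probability of moving from `x̄` to `x` under the control `u` -/
  trans : U → X → PMF X
  /-- `obs u x y` is the probability of measuring `y` in the new state `x` after the control `u` -/
  obs : U → X → PMF Y
  /-- cost `c(X_0, X_k, U_k)` of the initial state, current state and control -/
  cost : X → X → U → ℝ
  /-- cost `ψ(ξ_k, U_k)` of the joint posterior of `(X_0, X_k)` and the control -/
  ψ : PMF (X × X) → U → ℝ
  /-- discount factor -/
  γ : ℝ
  γ_pos : 0 < γ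
  γ_lt_one : γ < 1

/-- The state `X_k` along a trajectory. -/
def stateAt {X Y U : Type*} (ω : ∀ k, Stage X Y U k) (k : ℕ) : X := (ω k).1

/-- The records `(Y_k, U_k)_k` along a trajectory. -/
def records {X Y U : Type*} (ω : ∀ k, Stage X Y U k) : ∀ k, Record Y U k := fun k => (ω k).2

/-- The event that `Y^k = y` and `U^{k-1} = u`. -/
def infoEvent {X Y U : Type*} (k : ℕ) (y : Fin k → Y) (u : Fin k → U) :
    Set (∀ k, Stage X Y U k) :=
  {ω | obsHist (records ω) k = y ∧ ctrlHist (records ω) k = u}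

theorem measurable_pair {X Y U : Type*} [MeasurableSpace X] (k : ℕ) :
    Measurable fun ω : ∀ k, Stage X Y U k => (stateAt ω 0, stateAt ω k) := by
  have h (j : ℕ) : Measurable fun ω : ∀ k, Stage X Y U k => stateAt ω j :=
    (Measurable.of_discrete (f := fun z : Stage X Y U j => z.1)).comp (measurable_pi_apply j)
  exact (h 0).prodMk (h k)

open Classical in
/-- The joint conditional pmf of `(X_0, X_k)` given an event `A` under the law `P`. If `A` is a null
event, it is the pmf `p₀`, by convention. -/
def condPairPMF {X Y U : Type*} [Countable X] (P : Measure (∀ k, Stage X Y U k))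
    [IsProbabilityMeasure P] (p₀ : PMF (X × X)) (k : ℕ) (A : Set (∀ k, Stage X Y U k)) :
    PMF (X × X) :=
  letI : MeasurableSpace X := ⊤
  if h : P A ≠ 0 then
    haveI := cond_isProbabilityMeasure (μ := P) h
    haveI : IsProbabilityMeasure ((P[|A]).map fun ω => (stateAt ω 0, stateAt ω k)) :=
      Measure.isProbabilityMeasure_map (measurable_pair k).aemeasurable
    ((P[|A]).map fun ω => (stateAt ω 0, stateAt ω k)).toPMF
  else p₀

namespace ISCPOMDP

variable {X U Y : Type*} (M : ISCPOMDP X U Y)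

section

variable [Countable X] [Countable U] [Countable Y]

/-- The law `p_μ` of the trajectory `(X_0, U_0, X_1, Y_1, U_1, …)` under the policy `μ`:
`X_0 ∼ π_0`, `X_{k+1} | X_k, U_k ∼ A(U_k)`, `Y_{k+1} | X_{k+1}, U_k ∼ B(U_k)` and
`U_k = μ (Y^k, U^{k-1})`. -/
def law (μ : HistoryPolicy Y U) : Measure (∀ k, Stage X Y U k) :=
  processLaw (E := Stage X Y U)
    (M.init.map fun x => (x, (PUnit.unit, μ 0 Fin.elim0 Fin.elim0))) fun n h =>
    let x : X := (h ⟨n, Finset.mem_Iic.2 le_rfl⟩).1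
    let y : Fin n → Y := pastObs fun i => (h i).2
    let u : Fin (n + 1) → U := pastCtrl fun i => (h i).2
    (M.trans (u (Fin.last n)) x).bind fun x' =>
      (M.obs (u (Fin.last n)) x').map fun y' =>
        (x', (y', μ (n + 1) (Fin.snoc (α := fun _ => Y) y y') u))

instance (μ : HistoryPolicy Y U) : IsProbabilityMeasure (M.law μ) := by
  unfold law
  infer_instance

/-- The joint posterior pmf `p(X_0 = x_0, X_k = x_k | y^k, u^{k-1})` under the policy `μ`. -/
def posterior (μ : HistoryPolicy Y U) (k : ℕ) (y : Fin k → Y) (u : Fin k → U) : PMF (X × X) :=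
  condPairPMF (M.law μ) (M.init.map fun x => (x, x)) k (infoEvent k y u)

/-- The posterior process `ξ_k` along a trajectory. -/
def posteriorAt (μ : HistoryPolicy Y U) (ω : ∀ k, Stage X Y U k) (k : ℕ) : PMF (X × X) :=
  M.posterior μ k (obsHist (records ω) k) (ctrlHist (records ω) k)

/-- The `k`-th term `γ^k [c(X_0, X_k, U_k) + ψ(ξ_k, U_k)]` of the discounted cost. -/
def costTerm (μ : HistoryPolicy Y U) (ω : ∀ k, Stage X Y U k) (k : ℕ) : ℝ :=
  M.γ ^ k * (M.cost (stateAt ω 0) (stateAt ω k) (ctrlAt (records ω) k) +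
    M.ψ (M.posteriorAt μ ω k) (ctrlAt (records ω) k))

/-- `E_μ [∑_k γ^k [c(X_0, X_k, U_k) + ψ(ξ_k, U_k)]]`. -/
def expectedCost (μ : HistoryPolicy Y U) : ℝ := ∫ ω, ∑' k, M.costTerm μ ω k ∂(M.law μ)

/-- The optimal value of the ISC-POMDP. -/
def value : ℝ := ⨅ μ : HistoryPolicy Y U, M.expectedCost μ

/-- The policy `μ` solves the ISC-POMDP. -/
def IsOptimal (μ : HistoryPolicy Y U) : Prop :=
  ∀ μ' : HistoryPolicy Y U, M.expectedCost μ ≤ M.expectedCost μ'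

end

/-- The augmented-state POMDP on `S`, where `L` labels the pairs `(x_0, x)` of an initial and a
current state by the elements of `S`. -/
def augmented {S : Type*} (L : X × X ≃ S) : POMDP S U Y where
  init := M.init.map fun x => L (x, x)
  trans u s := (M.trans u (L.symm s).2).map fun x => L ((L.symm s).1, x)
  obs u s := M.obs u (L.symm s).2
  cost s u := M.cost (L.symm s).1 (L.symm s).2 u
  γ := M.γ
  γ_pos := M.γ_pos
  γ_lt_one := M.γ_lt_one

/-- The augmented transition probabilities in closed form. -/
theorem augmented_trans_apply {S : Type*} (L : X × X ≃ S) (u : U) (x₀ x₀' x x' : X)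
    [Decidable (x₀' = x₀)] :
    (M.augmented L).trans u (L (x₀, x)) (L (x₀', x')) =
      if x₀' = x₀ then M.trans u x x' else 0 := by
  classical
  simp only [augmented, Equiv.symm_apply_apply, PMF.map_apply, L.injective.eq_iff, Prod.mk.injEq]
  split_ifs with h
  · simp [h]
  · simp [h]

/-- The augmented measurement probabilities in closed form. -/
theorem augmented_obs_apply {S : Type*} (L : X × X ≃ S) (u : U) (x₀ x : X) (y : Y) :
    (M.augmented L).obs u (L (x₀, x)) y = M.obs u x y := by
  simp [augmented]

end ISCPOMDP

end

/-!
The augmented state `S_k = L (X_0, X_k)` is itself a controlled Markov chain: its first component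
never moves and its second component follows the dynamics of the ISC-POMDP. Under any
history-dependent policy, the pair (next augmented state, next measurement) therefore has the
conditional law given by the augmented transition and measurement kernels
(`ISCPOMDP.integral_law_succ`), which is proved from the Ionescu-Tulcea construction.

Bayes' rule (`POMDP.mean_trans_obs_eq_mean_filter`) and induction on time then show that, given the
measurements and controls, `S_k` is distributed according to the belief computed by the filter
(`ISCPOMDP.integral_eq_integral_mean_belief`). Here it matters that the policy is a function of the
measurements and controls alone, so that the control carries no further information on the state.
Consequently the posterior is the belief, the next measurement has the predictive law of the belief,
the measurements and controls under a belief policy form the belief process (a process law is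
determined by its conditional pmfs, `eq_processLaw`), and, when `ψ = 0`, the expected cost
`c (X_0, X_k, U_k)` is the expected linear belief cost.

For the optimization problems, the Bellman equation of the belief process has a bounded solution `V`
(`exists_bellman_solution`; costs are bounded and there are finitely many controls, so the Bellman
operator is a contraction). The cost of any history-dependent policy is `V` at the initial belief
plus the discounted expected Bellman defects (`ISCPOMDP.expectedCost_eq_add_defects`), which are
nonnegative, and vanish for the belief policy that selects minimizers. So that belief policy is
optimal among all history-dependent policies, and both problems have the value `V` at the initial
belief.

Averages are written as real integrals and means of pmfs throughout; probabilities are recovered as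
integrals of indicators.
-/

noncomputable section

/-! ### Means of probability mass functions -/

/-- The mean of the real function `f` under the pmf `p`. -/
def PMF.mean {α : Type*} (p : PMF α) (f : α → ℝ) : ℝ := ∑' a, (p a).toReal * f a

namespace PMF

variable {α β : Type*}

theorem mean_eq_sum [Fintype α] (p : PMF α) (f : α → ℝ) :
    p.mean f = ∑ a, (p a).toReal * f a := tsum_fintype _

theorem sum_toReal [Fintype α] (p : PMF α) : ∑ a, (p a).toReal = 1 := by
  rw [← ENNReal.toReal_sum fun a _ => p.apply_ne_top a, ← tsum_fintype (L := .unconditional _),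
    p.tsum_coe, ENNReal.toReal_one]

theorem integral_toMeasure [Finite α] [MeasurableSpace α] [MeasurableSingletonClass α]
    (p : PMF α) (f : α → ℝ) : ∫ a, f a ∂p.toMeasure = p.mean f := by
  cases nonempty_fintype α
  simp [PMF.integral_eq_sum, mean_eq_sum]

theorem mean_const [Finite α] (p : PMF α) (c : ℝ) : p.mean (fun _ => c) = c := by
  cases nonempty_fintype α
  rw [mean_eq_sum, ← Finset.sum_mul, sum_toReal, one_mul]

theorem mean_bind [Finite α] [Finite β] (p : PMF α) (q : α → PMF β) (f : β → ℝ) :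
    (p.bind q).mean f = p.mean fun a => (q a).mean f := by
  cases nonempty_fintype α
  cases nonempty_fintype β
  simp only [mean_eq_sum, PMF.bind_apply, tsum_fintype, Finset.mul_sum]
  rw [Finset.sum_comm]
  refine Finset.sum_congr rfl fun b _ => ?_
  rw [ENNReal.toReal_sum fun a _ => ENNReal.mul_ne_top (p.apply_ne_top a) ((q a).apply_ne_top b),
    Finset.sum_mul]
  simp only [ENNReal.toReal_mul, mul_assoc]

theorem mean_pure [Finite α] (a : α) (f : α → ℝ) : (PMF.pure a).mean f = f a := by
  cases nonempty_fintype α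
  classical
  rw [mean_eq_sum, Finset.sum_eq_single a (fun b _ hb => by simp [PMF.pure_apply, hb]) (by simp)]
  simp [PMF.pure_apply]

theorem mean_map [Finite α] [Finite β] (p : PMF α) (g : α → β) (f : β → ℝ) :
    (p.map g).mean f = p.mean fun a => f (g a) := by
  rw [← PMF.bind_pure_comp, mean_bind]
  simp [mean_pure]

theorem mean_ite_eq [Finite α] [DecidableEq α] (p : PMF α) (a : α) :
    p.mean (fun b => if b = a then 1 else 0) = (p a).toReal := by
  cases nonempty_fintype α
  simp [mean_eq_sum]

theorem mean_mono [Finite α] (p : PMF α) {f g : α → ℝ} (h : ∀ a, f a ≤ g a) :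
    p.mean f ≤ p.mean g := by
  cases nonempty_fintype α
  simp only [mean_eq_sum]
  exact Finset.sum_le_sum fun a _ => mul_le_mul_of_nonneg_left (h a) ENNReal.toReal_nonneg

theorem abs_mean_le [Finite α] (p : PMF α) {f : α → ℝ} {B : ℝ} (h : ∀ a, |f a| ≤ B) :
    |p.mean f| ≤ B :=
  abs_le.2 ⟨(p.mean_const (-B)).symm.le.trans (p.mean_mono fun a => (abs_le.1 (h a)).1),
    (p.mean_mono fun a => (abs_le.1 (h a)).2).trans (p.mean_const B).le⟩

theorem abs_mean_sub_mean_le [Finite α] (p : PMF α) {f g : α → ℝ} {B : ℝ}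
    (h : ∀ a, |f a - g a| ≤ B) : |p.mean f - p.mean g| ≤ B := by
  refine le_trans (le_of_eq ?_) (p.abs_mean_le h)
  cases nonempty_fintype α
  simp only [mean_eq_sum, ← Finset.sum_sub_distrib, mul_sub]

end PMF

/-! ### Laws of processes with finitely many values at each time -/

section FiniteProcess

variable {E : ℕ → Type*} [∀ n, MeasurableSpace (E n)] [∀ n, DiscreteMeasurableSpace (E n)]
  [∀ n, Finite (E n)]

theorem measurable_frestrictLe {β : Type*} [MeasurableSpace β] (n : ℕ)
    (g : (∀ i : Finset.Iic n, E i) → β) :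
    Measurable fun ω : ∀ k, E k => g (Preorder.frestrictLe n ω) :=
  (measurable_of_countable g).comp (Preorder.measurable_frestrictLe n)

theorem integrable_frestrictLe (P : Measure (∀ k, E k)) [IsFiniteMeasure P] (n : ℕ)
    (g : (∀ i : Finset.Iic n, E i) → ℝ) :
    Integrable (fun ω => g (Preorder.frestrictLe n ω)) P := by
  have h : Integrable g (P.map (Preorder.frestrictLe n)) := .of_finite
  exact h.comp_measurable (Preorder.measurable_frestrictLe n)

/-- The defining property of the law of a process: given the past up to time `n`, the value at time
`n + 1` has the conditional pmf `step n`. -/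
theorem integral_processLaw_succ (p₀ : PMF (E 0))
    (step : ∀ n, (∀ i : Finset.Iic n, E i) → PMF (E (n + 1))) (n : ℕ)
    (g : (∀ i : Finset.Iic n, E i) → E (n + 1) → ℝ) :
    ∫ ω, g (Preorder.frestrictLe n ω) (ω (n + 1)) ∂processLaw p₀ step =
      ∫ ω, (step n (Preorder.frestrictLe n ω)).mean (g (Preorder.frestrictLe n ω))
        ∂processLaw p₀ step := by
  have key := Kernel.map_frestrictLe_trajMeasure_compProd_eq_map_trajMeasure
    (μ₀ := p₀.toMeasure) (κ := stepKernel step) (a := n)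
  have hm : Measurable fun ω : ∀ k, E k => (Preorder.frestrictLe n ω, ω (n + 1)) := by fun_prop
  have hg : Integrable (Function.uncurry g) ((processLaw p₀ step).map
      fun ω => (Preorder.frestrictLe n ω, ω (n + 1))) :=
    haveI := Measure.isProbabilityMeasure_map (μ := processLaw p₀ step) hm.aemeasurable
    .of_finite
  have h1 := integral_map (μ := processLaw p₀ step) hm.aemeasurable hg.aestronglyMeasurable
  simp only [Function.uncurry] at h1
  rw [← h1]
  change ∫ z, Function.uncurry g z ∂((Kernel.trajMeasure p₀.toMeasure (stepKernel step)).map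
      fun ω => (Preorder.frestrictLe n ω, ω (n + 1))) = _
  rw [← key]
  have hg' : Integrable (Function.uncurry g)
      (((processLaw p₀ step).map (Preorder.frestrictLe n)) ⊗ₘ stepKernel step n) := by
    unfold processLaw; rw [key]; exact hg
  change ∫ z, Function.uncurry g z
    ∂(((processLaw p₀ step).map (Preorder.frestrictLe n)) ⊗ₘ stepKernel step n) = _
  rw [Measure.integral_compProd hg', integral_map (by fun_prop)]
  · refine integral_congr_ae (.of_forall fun ω => ?_)
    exact PMF.integral_toMeasure _ _
  · exact (measurable_of_countable _).aestronglyMeasurable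

theorem integral_processLaw_zero (p₀ : PMF (E 0))
    (step : ∀ n, (∀ i : Finset.Iic n, E i) → PMF (E (n + 1))) (g : E 0 → ℝ) :
    ∫ ω, g (ω 0) ∂processLaw p₀ step = p₀.mean g := by
  have hev : Measurable fun ω : ∀ k, E k => ω 0 := measurable_pi_apply 0
  have h : (processLaw p₀ step).map (fun ω => ω 0) = p₀.toMeasure := by
    have h1 : (processLaw p₀ step).map (Preorder.frestrictLe 0) =
        p₀.toMeasure.map (MeasurableEquiv.piUnique fun i : Finset.Iic 0 => E i).symm := by
      unfold processLaw Kernel.trajMeasure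
      rw [Measure.map_comp _ _ (by fun_prop), Kernel.traj_map_frestrictLe,
        Kernel.partialTraj_self, Measure.id_comp]
      rfl
    let φ : (∀ i : Finset.Iic 0, E i) → E 0 := fun h => h ⟨0, Finset.mem_Iic.2 le_rfl⟩
    have hφ : Measurable φ := measurable_pi_apply _
    have he : Measurable fun z : E 0 =>
        (MeasurableEquiv.piUnique fun i : Finset.Iic 0 => E i).symm z :=
      MeasurableEquiv.measurable _
    calc (processLaw p₀ step).map (fun ω => ω 0)
        = ((processLaw p₀ step).map (Preorder.frestrictLe 0)).map φ :=
          (Measure.map_map hφ (Preorder.measurable_frestrictLe 0)).symm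
      _ = (p₀.toMeasure.map fun z : E 0 =>
          (MeasurableEquiv.piUnique fun i : Finset.Iic 0 => E i).symm z).map φ := by rw [h1]; rfl
      _ = p₀.toMeasure.map id := Measure.map_map hφ he
      _ = p₀.toMeasure := Measure.map_id
  rw [← PMF.integral_toMeasure, ← h, integral_map hev.aemeasurable]
  exact (measurable_of_countable _).aestronglyMeasurable

/-- A past up to time `n` followed by a value at time `n + 1`. -/
def pastSnoc {E : ℕ → Type*} {n : ℕ} (h : ∀ i : Finset.Iic n, E i) (z : E (n + 1)) :
    ∀ i : Finset.Iic (n + 1), E i := fun i =>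
  if hi : (i : ℕ) ≤ n then h ⟨i, Finset.mem_Iic.2 hi⟩
  else cast (congrArg E (show n + 1 = i by have := Finset.mem_Iic.1 i.2; omega)) z

theorem pastSnoc_frestrictLe {E : ℕ → Type*} (n : ℕ) (ω : ∀ k, E k) :
    pastSnoc (Preorder.frestrictLe n ω) (ω (n + 1)) = Preorder.frestrictLe (n + 1) ω := by
  funext i
  obtain ⟨i, hi⟩ := i
  by_cases h : i ≤ n
  · simp [pastSnoc, h]
  · obtain rfl : i = n + 1 := by have := Finset.mem_Iic.1 hi; omega
    simp [pastSnoc]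

/-- The law of a process is determined by its initial and conditional pmfs. -/
theorem eq_processLaw (P : Measure (∀ k, E k)) [IsProbabilityMeasure P] (p₀ : PMF (E 0))
    (step : ∀ n, (∀ i : Finset.Iic n, E i) → PMF (E (n + 1)))
    (h0 : ∀ g : E 0 → ℝ, ∫ ω, g (ω 0) ∂P = p₀.mean g)
    (hs : ∀ (n : ℕ) (g : (∀ i : Finset.Iic n, E i) → E (n + 1) → ℝ),
      ∫ ω, g (Preorder.frestrictLe n ω) (ω (n + 1)) ∂P =
        ∫ ω, (step n (Preorder.frestrictLe n ω)).mean (g (Preorder.frestrictLe n ω)) ∂P) :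
    P = processLaw p₀ step := by
  have h : ∀ (n : ℕ) (g : (∀ i : Finset.Iic n, E i) → ℝ),
      ∫ ω, g (Preorder.frestrictLe n ω) ∂P =
        ∫ ω, g (Preorder.frestrictLe n ω) ∂processLaw p₀ step := by
    intro n
    induction n with
    | zero =>
      intro g
      let e : E 0 → ∀ i : Finset.Iic 0, E i := fun z i =>
        cast (congrArg E (Nat.le_zero.1 (Finset.mem_Iic.1 i.2)).symm) z
      have he (ω : ∀ k, E k) : Preorder.frestrictLe 0 ω = e (ω 0) := by
        funext ⟨i, hi⟩
        obtain rfl : i = 0 := Nat.le_zero.1 (Finset.mem_Iic.1 hi)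
        rfl
      simp only [he]
      exact (h0 fun z => g (e z)).trans (integral_processLaw_zero p₀ step fun z => g (e z)).symm
    | succ n ih =>
      intro g
      simp only [← pastSnoc_frestrictLe]
      rw [hs n fun h z => g (pastSnoc h z), integral_processLaw_succ p₀ step n
        fun h z => g (pastSnoc h z)]
      exact ih fun h => (step n h).mean fun z => g (pastSnoc h z)
  have hmap (n : ℕ) : P.map (Preorder.frestrictLe n) =
      (processLaw p₀ step).map (Preorder.frestrictLe n) := by
    classical
    have := Measure.isProbabilityMeasure_map (μ := P)
      (Preorder.measurable_frestrictLe (X := E) n).aemeasurable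
    have := Measure.isProbabilityMeasure_map (μ := processLaw p₀ step)
      (Preorder.measurable_frestrictLe (X := E) n).aemeasurable
    refine Measure.ext_of_singleton fun a => ?_
    have h1 := h n (Set.indicator {a} 1)
    rw [← integral_map (φ := Preorder.frestrictLe n) (by fun_prop)
        (measurable_of_countable _).aestronglyMeasurable,
      ← integral_map (φ := Preorder.frestrictLe n) (by fun_prop)
        (measurable_of_countable _).aestronglyMeasurable,
      integral_indicator_one (measurableSet_singleton a),
      integral_indicator_one (measurableSet_singleton a)] at h1
    exact (measureReal_eq_measureReal_iff).1 h1
  have hproj : IsProjectiveLimit P fun I => (processLaw p₀ step).map I.restrict := by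
    rw [isProjectiveLimit_nat_iff]
    · exact hmap
    · intro I J hJI
      change _ = ((processLaw p₀ step).map I.restrict).map _
      rw [Measure.map_map (by fun_prop) (by fun_prop)]
      rfl
  have hproj' : IsProjectiveLimit (processLaw p₀ step)
      fun I => (processLaw p₀ step).map I.restrict := fun I => rfl
  have (I : Finset ℕ) : IsFiniteMeasure ((processLaw p₀ step).map I.restrict) :=
    inferInstance
  exact hproj.unique hproj'

end FiniteProcess

/-! ### Discounted sums -/

/-- Discounted sums of uniformly bounded measurable terms converge everywhere, are integrable, and
can be integrated term by term. -/
theorem integral_discounted_tsum {Ω : Type*} [MeasurableSpace Ω] (P : Measure Ω)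
    [IsProbabilityMeasure P] {γ B : ℝ} (hγ0 : 0 < γ) (hγ1 : γ < 1) (f : ℕ → Ω → ℝ)
    (hf : ∀ k, Measurable (f k)) (hB : ∀ k ω, |f k ω| ≤ B) :
    (∀ ω, Summable fun k => γ ^ k * f k ω) ∧ Integrable (fun ω => ∑' k, γ ^ k * f k ω) P ∧
      ∫ ω, ∑' k, γ ^ k * f k ω ∂P = ∑' k, γ ^ k * ∫ ω, f k ω ∂P := by
  have hg : Summable fun k => γ ^ k * B := (summable_geometric_of_lt_one hγ0.le hγ1).mul_right B
  have hle (k : ℕ) (ω : Ω) : ‖γ ^ k * f k ω‖ ≤ γ ^ k * B := by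
    rw [norm_mul, Real.norm_of_nonneg (pow_pos hγ0 k).le]
    exact mul_le_mul_of_nonneg_left (hB k ω) (pow_pos hγ0 k).le
  have hsum (ω : Ω) : Summable fun k => γ ^ k * f k ω := .of_norm_bounded hg fun k => hle k ω
  have hint (k : ℕ) : Integrable (fun ω => γ ^ k * f k ω) P :=
    .of_bound ((hf k).const_mul _).aestronglyMeasurable (γ ^ k * B) (.of_forall (hle k))
  have hs : Summable fun k => ∫ ω, ‖γ ^ k * f k ω‖ ∂P := by
    refine .of_nonneg_of_le (fun k => integral_nonneg fun ω => norm_nonneg _) (fun k => ?_) hg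
    refine (integral_mono (hint k).norm (integrable_const (γ ^ k * B)) (hle k)).trans ?_
    simp
  refine ⟨hsum, ?_, ?_⟩
  · refine .of_bound (C := ∑' k, γ ^ k * B) ?_ (.of_forall fun ω =>
      tsum_of_norm_bounded hg.hasSum fun k => hle k ω)
    refine aestronglyMeasurable_of_tendsto_ae Filter.atTop
      (f := fun n ω => ∑ k ∈ Finset.range n, γ ^ k * f k ω) (fun n => ?_)
      (.of_forall fun ω => (hsum ω).hasSum.tendsto_sum_nat)
    exact (Finset.measurable_fun_sum _ fun k _ => (hf k).const_mul _).aestronglyMeasurable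
  · rw [← integral_tsum_of_summable_integral_norm hint hs]
    exact tsum_congr fun k => integral_const_mul _ _

/-- Telescoping: a discounted sum of costs `c k` is the initial value `a 0` plus the discounted
sum of the Bellman defects `c k + γ a (k + 1) - a k`. -/
theorem discounted_tsum_eq_add_defects {γ B : ℝ} (hγ0 : 0 < γ) (hγ1 : γ < 1) (a c : ℕ → ℝ)
    (ha : ∀ k, |a k| ≤ B) (hc : ∀ k, |c k| ≤ B) :
    ∑' k, γ ^ k * c k = a 0 + ∑' k, γ ^ k * (c k + γ * a (k + 1) - a k) := by
  have hs (f : ℕ → ℝ) (hf : ∀ k, |f k| ≤ B) : Summable fun k => γ ^ k * f k := by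
    refine .of_norm_bounded ((summable_geometric_of_lt_one hγ0.le hγ1).mul_right B) fun k => ?_
    rw [norm_mul, Real.norm_of_nonneg (pow_pos hγ0 k).le]
    exact mul_le_mul_of_nonneg_left (hf k) (pow_pos hγ0 k).le
  have h1 : Summable fun k => γ ^ (k + 1) * a (k + 1) := (summable_nat_add_iff 1).2 (hs a ha)
  have h2 : (fun k => γ ^ k * (c k + γ * a (k + 1) - a k)) =
      fun k => γ ^ k * c k + γ ^ (k + 1) * a (k + 1) - γ ^ k * a k := by
    funext k; ring
  rw [h2, Summable.tsum_sub ((hs c hc).add h1) (hs a ha), Summable.tsum_add (hs c hc) h1,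
    (hs a ha).tsum_eq_zero_add]
  ring

/-! ### The Bellman equation -/

/-- The Bellman equation of a discounted decision problem with bounded costs and finitely many
controls has a bounded solution, as the Bellman operator is a contraction for the supremum norm;
`m` selects minimizing controls. The state space `α` carries no topology. -/
theorem exists_bellman_solution {α U Y : Type*} [Finite U] [Nonempty U] [Finite Y] {γ B : ℝ}
    (hγ0 : 0 < γ) (hγ1 : γ < 1) (C : α → U → ℝ) (hC : ∀ a u, |C a u| ≤ B) (p : α → U → PMF Y)
    (F : α → U → Y → α) :
    ∃ (V : α → ℝ) (m : α → U), (∃ B', ∀ a, |V a| ≤ B') ∧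
      (∀ a u, V a ≤ C a u + γ * (p a u).mean fun y => V (F a u y)) ∧
      ∀ a, V a = C a (m a) + γ * (p a (m a)).mean fun y => V (F a (m a) y) := by
  -- With the discrete topology, bounded functions form a complete space of continuous functions.
  let _ : TopologicalSpace α := ⊥
  have : DiscreteTopology α := ⟨rfl⟩
  let q (V : α → ℝ) (a : α) (u : U) : ℝ := C a u + γ * (p a u).mean fun y => V (F a u y)
  let T (V : BoundedContinuousFunction α ℝ) : BoundedContinuousFunction α ℝ :=
    BoundedContinuousFunction.ofNormedAddCommGroupDiscrete (fun a => ⨅ u, q V a u) (B + γ * ‖V‖)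
      fun a => by
        have hq (u : U) : |q V a u| ≤ B + γ * ‖V‖ := by
          refine (abs_add_le _ _).trans (add_le_add (hC a u) ?_)
          rw [abs_mul, abs_of_pos hγ0]
          exact mul_le_mul_of_nonneg_left (PMF.abs_mean_le _ fun y => V.norm_coe_le_norm _) hγ0.le
        obtain ⟨u, hu⟩ := exists_eq_ciInf_of_finite (f := q V a)
        rw [← hu]
        exact hq u
  have hT : ContractingWith ⟨γ, hγ0.le⟩ T := by
    refine ⟨hγ1, LipschitzWith.of_dist_le_mul fun V W => ?_⟩
    have hle (V W : BoundedContinuousFunction α ℝ) (a : α) :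
        (⨅ u, q V a u) - (⨅ u, q W a u) ≤ γ * dist V W := by
      obtain ⟨u, hu⟩ := exists_eq_ciInf_of_finite (f := q W a)
      rw [← hu]
      have h1 : (⨅ u, q V a u) ≤ q V a u := ciInf_le (Set.finite_range _).bddBelow u
      have h2 : |((p a u).mean fun y => V (F a u y)) - (p a u).mean fun y => W (F a u y)| ≤
          dist V W := PMF.abs_mean_sub_mean_le _ fun y => V.dist_coe_le_dist (F a u y)
      have h3 := mul_le_mul_of_nonneg_left (abs_le.1 h2).2 hγ0.le
      simp only [q] at h1 ⊢
      linarith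
    refine (BoundedContinuousFunction.dist_le (mul_nonneg hγ0.le dist_nonneg)).2 fun a => ?_
    refine abs_le.2 ⟨?_, hle V W a⟩
    have := hle W V a
    rw [dist_comm] at this
    change _ ≤ (⨅ u, q V a u) - (⨅ u, q W a u)
    linarith
  obtain ⟨V, hV, -⟩ := hT.exists_fixedPoint 0 (edist_ne_top _ _)
  have hVa (a : α) : V a = ⨅ u, q V a u := (DFunLike.congr_fun hV a).symm
  choose m hm using fun a => exists_eq_ciInf_of_finite (f := q V a)
  refine ⟨V, m, ⟨‖V‖, fun a => V.norm_coe_le_norm a⟩, fun a u => ?_, fun a => ?_⟩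
  · exact (hVa a).trans_le (ciInf_le (Set.finite_range _).bddBelow u)
  · exact (hVa a).trans (hm a).symm

/-! ### The Bayesian filter -/

namespace POMDP

variable {S U Y : Type*} [Fintype S] (Q : POMDP S U Y)

theorem obsLaw_eq_sum_filterNum (ξ : PMF S) (u : U) (y : Y) :
    Q.obsLaw ξ u y = ∑ s, Q.filterNum ξ u y s := by
  simp only [obsLaw, PMF.bind_apply, tsum_fintype, filterNum]
  refine Finset.sum_congr rfl fun s _ => ?_
  rw [mul_comm]
  exact congrArg _ (Finset.sum_congr rfl fun s' _ => mul_comm _ _)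

/-- Bayes' rule. It also holds for measurements of probability zero, whatever the convention for
the filter there, since then both sides vanish. -/
theorem obsLaw_mul_filter (ξ : PMF S) (u : U) (y : Y) (s : S) :
    Q.obsLaw ξ u y * Q.filter ξ u y s = Q.filterNum ξ u y s := by
  rw [obsLaw_eq_sum_filterNum, ← tsum_fintype (L := .unconditional _)]
  by_cases h : ∑' s, Q.filterNum ξ u y s = 0
  · rw [h, zero_mul, ENNReal.tsum_eq_zero.1 h s]
  · rw [filter, dif_pos h, PMF.normalize_apply, mul_comm, mul_assoc,
      ENNReal.inv_mul_cancel h (Q.tsum_filterNum_ne_top ξ u y), mul_one]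

/-- Disintegration of the joint law of the next state and measurement: averaging over the current
state, the next state and the measurement is the same as averaging over the measurement under its
predictive law and then over the next state under the updated belief. -/
theorem mean_trans_obs_eq_mean_filter [Finite Y] (ξ : PMF S) (u : U) (φ : S → Y → ℝ) :
    (ξ.mean fun s => (Q.trans u s).mean fun s' => (Q.obs u s').mean fun y => φ s' y) =
      (Q.obsLaw ξ u).mean fun y => (Q.filter ξ u y).mean fun s' => φ s' y := by
  cases nonempty_fintype Y
  rw [← PMF.mean_bind]
  simp only [PMF.mean_eq_sum, Finset.mul_sum]
  rw [Finset.sum_comm]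
  refine Finset.sum_congr rfl fun y _ => Finset.sum_congr rfl fun s' _ => ?_
  rw [← mul_assoc, ← mul_assoc, ← ENNReal.toReal_mul, ← ENNReal.toReal_mul, obsLaw_mul_filter,
    filterNum, PMF.bind_apply, tsum_fintype, mul_comm (∑ _, _)]
  simp only [mul_comm]

theorem belief_snoc (n : ℕ) (y : Fin n → Y) (u : Fin (n + 1) → U) (y' : Y) :
    Q.belief (n + 1) (Fin.snoc (α := fun _ => Y) y y') u =
      Q.filter (Q.belief n y fun j => u j.castSucc) (u (Fin.last n)) y' := by
  simp [belief]

theorem abs_beliefCost_le {B : ℝ} (hB : ∀ s u, |Q.cost s u| ≤ B) (ξ : PMF S) (u : U) :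
    |Q.beliefCost ξ u| ≤ B := by
  have h : Q.beliefCost ξ u = ξ.mean fun s => Q.cost s u := (PMF.mean_eq_sum _ _).symm
  rw [h]
  exact ξ.abs_mean_le fun s => hB s u

end POMDP

/-! ### The law of the ISC-POMDP -/

section Trajectories

variable {X U Y S : Type*}

instance [Finite Y] (k : ℕ) : Finite (Obs Y k) := by
  cases k with
  | zero => exact inferInstanceAs (Finite PUnit)
  | succ k => exact inferInstanceAs (Finite Y)

instance [Finite Y] [Finite U] (k : ℕ) : Finite (Record Y U k) :=
  inferInstanceAs (Finite (Obs Y k × U))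

instance [Finite X] [Finite Y] [Finite U] (k : ℕ) : Finite (Stage X Y U k) :=
  inferInstanceAs (Finite (X × Record Y U k))

theorem obsHist_succ (r : ∀ k, Record Y U k) (n : ℕ) :
    obsHist r (n + 1) = Fin.snoc (α := fun _ => Y) (obsHist r n) (obsSucc r n) := by
  funext j
  refine Fin.lastCases ?_ (fun i => ?_) j
  · simp [obsHist]
  · simp [obsHist]

theorem ctrlHist_succ (r : ∀ k, Record Y U k) (n : ℕ) :
    ctrlHist r (n + 1) = Fin.snoc (α := fun _ => U) (ctrlHist r n) (ctrlAt r n) := by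
  funext j
  refine Fin.lastCases ?_ (fun i => ?_) j
  · simp [ctrlHist]
  · simp [ctrlHist]

/-- The augmented state `S_k = L (X_0, X_k)` along a trajectory. -/
abbrev augState (L : X × X ≃ S) (ω : ∀ k, Stage X Y U k) (k : ℕ) : S :=
  L (stateAt ω 0, stateAt ω k)

theorem measurable_records : Measurable (records : (∀ k, Stage X Y U k) → ∀ k, Record Y U k) :=
  measurable_pi_lambda _ fun k =>
    (Measurable.of_discrete (f := fun z : Stage X Y U k => z.2)).comp (measurable_pi_apply k)

variable [Finite U] [Finite Y]

/-- Anything computed from the measurements and controls up to time `n` is measurable. -/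
theorem measurable_info {β : Type*} [MeasurableSpace β] (n : ℕ)
    (f : (Fin n → Y) → (Fin (n + 1) → U) → β) :
    Measurable fun r : ∀ k, Record Y U k => f (obsHist r n) (ctrlHist r (n + 1)) :=
  measurable_frestrictLe (E := Record Y U) n fun h => f (pastObs h) (pastCtrl h)

/-- Anything computed from the measurements and controls up to time `n` and from the states at the
times `0`, `n` and `n + 1` is measurable. -/
theorem measurable_stages [Finite X] {β : Type*} [MeasurableSpace β] (L : X × X ≃ S) (n : ℕ)
    (f : (Fin (n + 1) → Y) → (Fin (n + 2) → U) → S → S → β) :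
    Measurable fun ω : ∀ k, Stage X Y U k => f (obsHist (records ω) (n + 1))
      (ctrlHist (records ω) (n + 2)) (augState L ω n) (augState L ω (n + 1)) :=
  measurable_frestrictLe (E := Stage X Y U) (n + 1) fun h =>
    f (pastObs fun i => (h i).2) (pastCtrl fun i => (h i).2)
      (L ((h ⟨0, Finset.mem_Iic.2 (Nat.zero_le _)⟩).1, (h ⟨n, Finset.mem_Iic.2 n.le_succ⟩).1))
      (L ((h ⟨0, Finset.mem_Iic.2 (Nat.zero_le _)⟩).1, (h ⟨n + 1, Finset.mem_Iic.2 le_rfl⟩).1))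

end Trajectories

namespace ISCPOMDP

variable {X U Y S : Type*} [Finite X] [Finite U] [Finite Y] [Fintype S] (M : ISCPOMDP X U Y)
  (L : X × X ≃ S) (μ : HistoryPolicy Y U)

theorem integral_law_zero (f : U → S → ℝ) :
    ∫ ω, f (ctrlAt (records ω) 0) (augState L ω 0) ∂M.law μ =
      (M.augmented L).init.mean (f (μ 0 Fin.elim0 Fin.elim0)) := by
  refine (integral_processLaw_zero (E := Stage X Y U) _ _
    fun z : Stage X Y U 0 => f z.2.2 (L (z.1, z.1))).trans ?_
  have : Finite (X × Record Y U 0) := inferInstanceAs (Finite (Stage X Y U 0))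
  rw [augmented, PMF.mean_map]
  exact PMF.mean_map (β := Stage X Y U 0) _ _ _

/-- The augmented state is controlled by the kernels of the augmented POMDP: given the past up to
time `n`, the next augmented state `s'` and measurement `y'` have the augmented conditional pmfs,
and the next control is the one chosen by the policy. -/
theorem integral_law_succ (n : ℕ)
    (f : (Fin n → Y) → (Fin (n + 1) → U) → S → S → Y → U → ℝ) :
    ∫ ω, f (obsHist (records ω) n) (ctrlHist (records ω) (n + 1)) (augState L ω n)
        (augState L ω (n + 1)) (obsSucc (records ω) n) (ctrlAt (records ω) (n + 1)) ∂M.law μ =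
      ∫ ω, ((M.augmented L).trans (ctrlAt (records ω) n) (augState L ω n)).mean fun s' =>
        ((M.augmented L).obs (ctrlAt (records ω) n) s').mean fun y' =>
          f (obsHist (records ω) n) (ctrlHist (records ω) (n + 1)) (augState L ω n) s' y'
            (μ (n + 1) (Fin.snoc (α := fun _ => Y) (obsHist (records ω) n) y')
              (ctrlHist (records ω) (n + 1))) ∂M.law μ := by
  refine (integral_processLaw_succ (E := Stage X Y U) _ _ n fun h z =>
    f (pastObs fun i => (h i).2) (pastCtrl fun i => (h i).2)
      (L ((h ⟨0, Finset.mem_Iic.2 (Nat.zero_le _)⟩).1, (h ⟨n, Finset.mem_Iic.2 le_rfl⟩).1))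
      (L ((h ⟨0, Finset.mem_Iic.2 (Nat.zero_le _)⟩).1, z.1)) z.2.1 z.2.2).trans ?_
  refine integral_congr_ae (.of_forall fun ω => ?_)
  simp only [augmented, PMF.mean_map, Equiv.symm_apply_apply]
  have : Finite (X × Record Y U (n + 1)) := inferInstanceAs (Finite (Stage X Y U (n + 1)))
  refine (PMF.mean_bind (β := Stage X Y U (n + 1)) _ _ _).trans ?_
  refine congrArg _ (funext fun x' => ?_)
  exact PMF.mean_map (β := Stage X Y U (n + 1)) _ _ _

/-- The filtering theorem: given the measurements and controls up to time `n`, the augmented state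
`S_n` is distributed according to the belief. -/
theorem integral_eq_integral_mean_belief (n : ℕ)
    (f : (Fin n → Y) → (Fin (n + 1) → U) → S → ℝ) :
    ∫ ω, f (obsHist (records ω) n) (ctrlHist (records ω) (n + 1)) (augState L ω n) ∂M.law μ =
      ∫ ω, ((M.augmented L).beliefAt (records ω) n).mean
        (f (obsHist (records ω) n) (ctrlHist (records ω) (n + 1))) ∂M.law μ := by
  induction n with
  | zero =>
    have h (ω : ∀ k, Stage X Y U k) : obsHist (records ω) 0 = Fin.elim0 := Subsingleton.elim _ _
    have h' (ω : ∀ k, Stage X Y U k) : ctrlHist (records ω) 1 = fun _ => ctrlAt (records ω) 0 := by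
      funext j
      rw [Subsingleton.elim j 0]
      rfl
    simp only [h, h', Nat.reduceAdd]
    rw [M.integral_law_zero L μ fun u => f Fin.elim0 fun _ => u]
    refine ((M.integral_law_zero L μ fun u _ =>
      (M.augmented L).init.mean (f Fin.elim0 fun _ => u)).trans ?_).symm
    exact PMF.mean_const _ _
  | succ n ih =>
    -- Average over the step from `n` to `n + 1`, use the induction hypothesis, and apply Bayes.
    have key (g : (Fin n → Y) → (Fin (n + 1) → U) → S → Y → U → ℝ) :
        ∫ ω, g (obsHist (records ω) n) (ctrlHist (records ω) (n + 1))
            (augState L ω (n + 1)) (obsSucc (records ω) n) (ctrlAt (records ω) (n + 1)) ∂M.law μ =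
          ∫ ω, ((M.augmented L).obsLaw ((M.augmented L).beliefAt (records ω) n)
            (ctrlAt (records ω) n)).mean fun y' =>
              ((M.augmented L).filter ((M.augmented L).beliefAt (records ω) n)
                (ctrlAt (records ω) n) y').mean fun s' =>
                  g (obsHist (records ω) n) (ctrlHist (records ω) (n + 1)) s' y'
                    (μ (n + 1) (Fin.snoc (α := fun _ => Y) (obsHist (records ω) n) y')
                      (ctrlHist (records ω) (n + 1))) ∂M.law μ := by
      rw [M.integral_law_succ L μ n fun y u _ => g y u]
      refine (ih fun y u s => ((M.augmented L).trans (u (Fin.last n)) s).mean fun s' =>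
        ((M.augmented L).obs (u (Fin.last n)) s').mean fun y' => g y u s' y'
          (μ (n + 1) (Fin.snoc (α := fun _ => Y) y y') u)).trans ?_
      exact integral_congr_ae (.of_forall fun ω =>
        (M.augmented L).mean_trans_obs_eq_mean_filter _ _ _)
    simp only [ctrlHist_succ _ (n + 1), obsHist_succ _ n, POMDP.beliefAt]
    rw [key fun y u s' y' u' => f (Fin.snoc (α := fun _ => Y) y y')
      (Fin.snoc (α := fun _ => U) u u') s']
    rw [key fun y u _ y' u' => ((M.augmented L).belief (n + 1) (Fin.snoc (α := fun _ => Y) y y')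
      u).mean (f (Fin.snoc (α := fun _ => Y) y y') (Fin.snoc (α := fun _ => U) u u'))]
    refine integral_congr_ae (.of_forall fun ω => ?_)
    simp only [PMF.mean_const, POMDP.belief_snoc]
    rfl

/-- The measurement and control process under the policy `μ`: given the past, the next measurement
has the predictive law of the current belief. -/
theorem integral_obs_succ (n : ℕ) (f : (Fin n → Y) → (Fin (n + 1) → U) → Y → U → ℝ) :
    ∫ ω, f (obsHist (records ω) n) (ctrlHist (records ω) (n + 1)) (obsSucc (records ω) n)
        (ctrlAt (records ω) (n + 1)) ∂M.law μ =
      ∫ ω, ((M.augmented L).obsLaw ((M.augmented L).beliefAt (records ω) n)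
        (ctrlAt (records ω) n)).mean fun y' =>
          f (obsHist (records ω) n) (ctrlHist (records ω) (n + 1)) y'
            (μ (n + 1) (Fin.snoc (α := fun _ => Y) (obsHist (records ω) n) y')
              (ctrlHist (records ω) (n + 1))) ∂M.law μ := by
  rw [M.integral_law_succ L μ n fun y u _ _ => f y u]
  refine (M.integral_eq_integral_mean_belief L μ n fun y u s =>
    ((M.augmented L).trans (u (Fin.last n)) s).mean fun s' =>
      ((M.augmented L).obs (u (Fin.last n)) s').mean fun y' => f y u y'
        (μ (n + 1) (Fin.snoc (α := fun _ => Y) y y') u)).trans ?_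
  refine integral_congr_ae (.of_forall fun ω => ?_)
  refine ((M.augmented L).mean_trans_obs_eq_mean_filter _ _ fun _ y' =>
    f (obsHist (records ω) n) (ctrlHist (records ω) (n + 1)) y'
      (μ (n + 1) (Fin.snoc (α := fun _ => Y) (obsHist (records ω) n) y')
        (ctrlHist (records ω) (n + 1)))).trans ?_
  simp only [PMF.mean_const]
  rfl

end ISCPOMDP

/-- The records up to time `n` with given measurements and controls. -/
def recordsOfHist {Y U : Type*} {n : ℕ} (y : Fin n → Y) (u : Fin (n + 1) → U) :
    ∀ i : Finset.Iic n, Record Y U i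
  | ⟨0, _⟩ => (PUnit.unit, u 0)
  | ⟨j + 1, h⟩ => (y ⟨j, Finset.mem_Iic.1 h⟩, u ⟨j + 1, Nat.lt_succ_of_le (Finset.mem_Iic.1 h)⟩)

theorem recordsOfHist_obsHist_ctrlHist {Y U : Type*} (r : ∀ k, Record Y U k) (n : ℕ) :
    recordsOfHist (obsHist r n) (ctrlHist r (n + 1)) = Preorder.frestrictLe n r := by
  funext ⟨i, hi⟩
  cases i with
  | zero => rfl
  | succ j => rfl

/-! ### Conditional probabilities under the ISC-POMDP -/

theorem integral_ite_one {Ω : Type*} [MeasurableSpace Ω] (P : Measure Ω) {a : Ω → Prop}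
    [DecidablePred a] (ha : MeasurableSet {ω | a ω}) :
    ∫ ω, (if a ω then (1 : ℝ) else 0) ∂P = P.real {ω | a ω} := by
  rw [← integral_indicator_one ha]
  refine integral_congr_ae (.of_forall fun ω => ?_)
  by_cases h : a ω <;> simp [h]

/-- A conditional probability, read off from integrals of indicators. -/
theorem cond_eq_of_integral {Ω : Type*} [MeasurableSpace Ω] (P : Measure Ω) [IsFiniteMeasure P]
    {a b : Ω → Prop} [DecidablePred a] [DecidablePred b]
    (ha : MeasurableSet {ω | a ω}) (hb : MeasurableSet {ω | b ω}) {t : ℝ≥0∞}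
    (ht : t ≠ ∞) (h : ∫ ω, (if a ω ∧ b ω then (1 : ℝ) else 0) ∂P =
      ∫ ω, (if a ω then (1 : ℝ) else 0) * t.toReal ∂P) (h0 : P {ω | a ω} ≠ 0) :
    ProbabilityTheory.cond P {ω | a ω} {ω | b ω} = t := by
  have hab : MeasurableSet {ω | a ω ∧ b ω} := ha.inter hb
  rw [integral_mul_const, integral_ite_one P ha, integral_ite_one P hab, measureReal_def,
    measureReal_def, ← ENNReal.toReal_mul, ENNReal.toReal_eq_toReal_iff' (measure_ne_top _ _)
      (ENNReal.mul_ne_top (measure_ne_top _ _) ht)] at h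
  rw [cond_apply ha, show {ω | a ω} ∩ {ω | b ω} = {ω | a ω ∧ b ω} from rfl, h, ← mul_assoc,
    ENNReal.inv_mul_cancel h0 (measure_ne_top _ _), one_mul]

theorem measurableSet_infoEvent {X Y U : Type*} [Finite Y] [Finite U] (k : ℕ)
    (y : Fin k → Y) (u : Fin k → U) :
    MeasurableSet (infoEvent k y u : Set (∀ k, Stage X Y U k)) :=
  measurable_records (measurableSet_setOfPred.2 (measurable_info k fun z v =>
    z = y ∧ (fun j => v (Fin.castSucc j)) = u))

namespace ISCPOMDP

variable {X U Y S : Type*} [Finite X] [Finite U] [Finite Y] [Fintype S] (M : ISCPOMDP X U Y)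
  (L : X × X ≃ S) (μ : HistoryPolicy Y U)

theorem law_augState_zero (s : S) :
    M.law μ {ω | augState L ω 0 = s} = (M.augmented L).init s := by
  classical
  have hm : MeasurableSet {ω : ∀ k, Stage X Y U k | augState L ω 0 = s} :=
    measurableSet_setOfPred.2 (measurable_stages L 0 fun _ _ s₀ _ => s₀ = s)
  have h := M.integral_law_zero L μ fun _ s' => if s' = s then 1 else 0
  rw [integral_ite_one _ hm, PMF.mean_ite_eq] at h
  exact (ENNReal.toReal_eq_toReal_iff' (measure_ne_top _ _) (PMF.apply_ne_top _ _)).1 h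

theorem cond_augState_succ (k : ℕ) (s s' : S) (u : U)
    (h0 : M.law μ {ω | augState L ω k = s ∧ ctrlAt (records ω) k = u} ≠ 0) :
    ProbabilityTheory.cond (M.law μ) {ω | augState L ω k = s ∧ ctrlAt (records ω) k = u}
      {ω | augState L ω (k + 1) = s'} = (M.augmented L).trans u s s' := by
  classical
  refine cond_eq_of_integral _
    (a := fun ω => augState L ω k = s ∧ ctrlAt (records ω) k = u)
    (b := fun ω => augState L ω (k + 1) = s')
    (measurableSet_setOfPred.2 (measurable_stages L k fun _ v σ _ =>
      σ = s ∧ v (Fin.last k).castSucc = u))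
    (measurableSet_setOfPred.2 (measurable_stages L k fun _ _ _ σ => σ = s'))
    (PMF.apply_ne_top _ _) ?_ h0
  refine (M.integral_law_succ L μ k fun _ v σ σ' _ _ =>
    if (σ = s ∧ v (Fin.last k) = u) ∧ σ' = s' then 1 else 0).trans ?_
  refine integral_congr_ae (.of_forall fun ω => ?_)
  simp only [PMF.mean_const]
  change ((M.augmented L).trans (ctrlAt (records ω) k) (augState L ω k)).mean (fun σ' =>
    if (augState L ω k = s ∧ ctrlAt (records ω) k = u) ∧ σ' = s' then 1 else 0) = _
  by_cases h : augState L ω k = s ∧ ctrlAt (records ω) k = u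
  · simp only [h, and_self, true_and, if_true, PMF.mean_ite_eq, one_mul]
  · simp only [h, false_and, if_false, PMF.mean_const, zero_mul]

theorem cond_obsSucc_augState (k : ℕ) (s : S) (u : U) (y : Y)
    (h0 : M.law μ {ω | augState L ω (k + 1) = s ∧ ctrlAt (records ω) k = u} ≠ 0) :
    ProbabilityTheory.cond (M.law μ) {ω | augState L ω (k + 1) = s ∧ ctrlAt (records ω) k = u}
      {ω | obsSucc (records ω) k = y} = (M.augmented L).obs u s y := by
  classical
  refine cond_eq_of_integral _
    (a := fun ω => augState L ω (k + 1) = s ∧ ctrlAt (records ω) k = u)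
    (b := fun ω => obsSucc (records ω) k = y)
    (measurableSet_setOfPred.2 (measurable_stages L k fun _ v _ σ =>
      σ = s ∧ v (Fin.last k).castSucc = u))
    (measurableSet_setOfPred.2 (measurable_stages L k fun z _ _ _ => z (Fin.last k) = y))
    (PMF.apply_ne_top _ _) ?_ h0
  refine (M.integral_law_succ L μ k fun _ v _ σ' y' _ =>
    if (σ' = s ∧ v (Fin.last k) = u) ∧ y' = y then 1 else 0).trans (Eq.trans ?_
      (M.integral_law_succ L μ k fun _ v _ σ' _ _ =>
        (if σ' = s ∧ v (Fin.last k) = u then 1 else 0) *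
          ((M.augmented L).obs u s y).toReal).symm)
  refine integral_congr_ae (.of_forall fun ω => congrArg _ (funext fun σ' => ?_))
  change ((M.augmented L).obs (ctrlAt (records ω) k) σ').mean (fun y' =>
    if (σ' = s ∧ ctrlAt (records ω) k = u) ∧ y' = y then 1 else 0) =
    ((M.augmented L).obs (ctrlAt (records ω) k) σ').mean fun y' =>
      (if σ' = s ∧ ctrlAt (records ω) k = u then 1 else 0) * ((M.augmented L).obs u s y).toReal
  rw [PMF.mean_const]
  by_cases h : σ' = s ∧ ctrlAt (records ω) k = u
  · simp only [h, and_self, true_and, if_true, PMF.mean_ite_eq, one_mul]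
  · simp only [h, false_and, if_false, PMF.mean_const, zero_mul]

/-- On information events of positive probability the posterior is the belief. -/
theorem posterior_map_eq_belief (k : ℕ) (y : Fin k → Y) (u : Fin k → U)
    (h0 : M.law μ (infoEvent k y u) ≠ 0) :
    (M.posterior μ k y u).map L = (M.augmented L).belief k y u := by
  classical
  ext s
  have hL : (M.posterior μ k y u).map L s = M.posterior μ k y u (L.symm s) := by
    rw [PMF.map_apply, tsum_eq_single (L.symm s)]
    · simp
    · intro b hb
      rw [if_neg]
      rintro rfl
      simp at hb
  have hm : MeasurableSet {ω : ∀ k, Stage X Y U k | augState L ω k = s} :=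
    measurableSet_setOfPred.2 (measurable_stages L k fun _ _ σ _ => σ = s)
  have hc : M.posterior μ k y u (L.symm s) =
      ProbabilityTheory.cond (M.law μ) (infoEvent k y u) {ω | augState L ω k = s} := by
    let _ : MeasurableSpace X := ⊤
    rw [posterior, condPairPMF, dif_pos h0, Measure.toPMF_apply,
      Measure.map_apply (measurable_pair k) (measurableSet_singleton _)]
    congr 1
    ext ω
    simp [augState, Equiv.eq_symm_apply]
  rw [hL, hc]
  refine cond_eq_of_integral (M.law μ)
    (a := fun ω => obsHist (records ω) k = y ∧ ctrlHist (records ω) k = u)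
    (b := fun ω => augState L ω k = s)
    (measurableSet_infoEvent k y u) hm (PMF.apply_ne_top _ _) ?_ h0
  refine (M.integral_eq_integral_mean_belief L μ k fun z v σ =>
    if (z = y ∧ (fun j => v (Fin.castSucc j)) = u) ∧ σ = s then 1 else 0).trans ?_
  refine integral_congr_ae (.of_forall fun ω => ?_)
  change ((M.augmented L).belief k (obsHist (records ω) k) (ctrlHist (records ω) k)).mean (fun σ =>
    if (obsHist (records ω) k = y ∧ ctrlHist (records ω) k = u) ∧ σ = s then 1 else 0) = _
  by_cases h : obsHist (records ω) k = y ∧ ctrlHist (records ω) k = u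
  · simp only [h, and_self, true_and, if_true, PMF.mean_ite_eq, one_mul]
  · simp only [h, false_and, if_false, PMF.mean_const, zero_mul]

theorem cond_obsSucc_infoEvent (k : ℕ) (y : Fin k → Y) (u : Fin k → U) (v : U) (y' : Y)
    (h0 : M.law μ {ω | ω ∈ infoEvent k y u ∧ ctrlAt (records ω) k = v} ≠ 0) :
    ProbabilityTheory.cond (M.law μ) {ω | ω ∈ infoEvent k y u ∧ ctrlAt (records ω) k = v}
      {ω | obsSucc (records ω) k = y'} =
        (M.augmented L).obsLaw ((M.posterior μ k y u).map L) v y' := by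
  classical
  rw [M.posterior_map_eq_belief L μ k y u
    fun h => h0 (measure_mono_null (fun ω hω => hω.1) h)]
  have hm : MeasurableSet {ω : ∀ k, Stage X Y U k |
      ω ∈ infoEvent k y u ∧ ctrlAt (records ω) k = v} :=
    (measurableSet_infoEvent k y u).inter (measurable_records (measurableSet_setOfPred.2
      (measurable_info k fun _ w => w (Fin.last k) = v)))
  refine cond_eq_of_integral _
    (a := fun ω => (obsHist (records ω) k = y ∧ ctrlHist (records ω) k = u) ∧
      ctrlAt (records ω) k = v)
    (b := fun ω => obsSucc (records ω) k = y') hm (measurable_records (measurableSet_setOfPred.2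
    (measurable_info (k + 1) fun z _ => z (Fin.last k) = y'))) (PMF.apply_ne_top _ _) ?_ h0
  refine (M.integral_obs_succ L μ k fun z w y'' _ =>
    if ((z = y ∧ (fun j => w (Fin.castSucc j)) = u) ∧ w (Fin.last k) = v) ∧ y'' = y'
      then 1 else 0).trans ?_
  refine integral_congr_ae (.of_forall fun ω => ?_)
  change ((M.augmented L).obsLaw ((M.augmented L).belief k (obsHist (records ω) k)
    (ctrlHist (records ω) k)) (ctrlAt (records ω) k)).mean (fun y'' =>
      if ((obsHist (records ω) k = y ∧ ctrlHist (records ω) k = u) ∧ ctrlAt (records ω) k = v) ∧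
        y'' = y' then 1 else 0) =
    (if (obsHist (records ω) k = y ∧ ctrlHist (records ω) k = u) ∧ ctrlAt (records ω) k = v
      then 1 else 0) * _
  by_cases h : (obsHist (records ω) k = y ∧ ctrlHist (records ω) k = u) ∧ ctrlAt (records ω) k = v
  · simp only [h, and_self, true_and, if_true, PMF.mean_ite_eq, one_mul]
  · simp only [h, false_and, if_false, PMF.mean_const, zero_mul]

/-- Almost surely all posteriors are the beliefs of the augmented POMDP: there are only countably
many information events, so that a trajectory almost surely avoids those of probability zero. -/
theorem ae_posteriorAt_map_eq_beliefAt :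
    ∀ᵐ ω ∂M.law μ, ∀ k, (M.posteriorAt μ ω k).map L = (M.augmented L).beliefAt (records ω) k := by
  rw [ae_all_iff]
  intro k
  have h : ∀ᵐ ω ∂M.law μ, ∀ z : (Fin k → Y) × (Fin k → U),
      M.law μ (infoEvent k z.1 z.2) = 0 → ω ∉ infoEvent k z.1 z.2 :=
    ae_all_iff.2 fun z => by
      by_cases h0 : M.law μ (infoEvent k z.1 z.2) = 0
      · filter_upwards [measure_eq_zero_iff_ae_notMem.1 h0] with ω hω _ using hω
      · exact .of_forall fun ω h => absurd h h0
  filter_upwards [h] with ω hω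
  exact M.posterior_map_eq_belief L μ k _ _ fun h0 =>
    hω (obsHist (records ω) k, ctrlHist (records ω) k) h0 ⟨rfl, rfl⟩

/-- Almost surely the controls are those prescribed by the policy. -/
theorem ae_ctrlAt_eq (k : ℕ) :
    ∀ᵐ ω ∂M.law μ, ctrlAt (records ω) k = μ k (obsHist (records ω) k) (ctrlHist (records ω) k) := by
  classical
  have hm : MeasurableSet {ω : ∀ k, Stage X Y U k |
      ¬ ctrlAt (records ω) k = μ k (obsHist (records ω) k) (ctrlHist (records ω) k)} :=
    measurable_records (measurableSet_setOfPred.2 (measurable_info k fun z v =>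
      ¬ v (Fin.last k) = μ k z fun j => v (Fin.castSucc j)))
  have h : ∫ ω, (if ¬ ctrlAt (records ω) k =
      μ k (obsHist (records ω) k) (ctrlHist (records ω) k) then (1 : ℝ) else 0) ∂M.law μ = 0 := by
    let L : X × X ≃ X × X := Equiv.refl _
    cases nonempty_fintype X
    cases k with
    | zero =>
      have h1 (ω : ∀ k, Stage X Y U k) : obsHist (records ω) 0 = Fin.elim0 := Subsingleton.elim _ _
      have h2 (ω : ∀ k, Stage X Y U k) : ctrlHist (records ω) 0 = Fin.elim0 := Subsingleton.elim _ _
      simp only [h1, h2]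
      refine (M.integral_law_zero L μ fun u _ =>
        if ¬ u = μ 0 Fin.elim0 Fin.elim0 then 1 else 0).trans ?_
      simp [PMF.mean_const]
    | succ n =>
      simp only [obsHist_succ]
      refine (M.integral_obs_succ L μ n fun z v y' u' =>
        if ¬ u' = μ (n + 1) (Fin.snoc (α := fun _ => Y) z y') v then 1 else 0).trans ?_
      simp [PMF.mean_const]
  rw [integral_ite_one _ hm, measureReal_eq_zero_iff] at h
  exact h

/-! ### Measurements and controls under a belief policy -/

theorem map_records_law (m : (M.augmented L).BeliefPolicy) :
    (M.law ((M.augmented L).toHistoryPolicy m)).map records = (M.augmented L).law m := by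
  have := Measure.isProbabilityMeasure_map
    (μ := M.law ((M.augmented L).toHistoryPolicy m)) (measurable_records (X := X)).aemeasurable
  have hmap {f : (∀ k, Record Y U k) → ℝ} (hf : Measurable f) :
      ∫ r, f r ∂(M.law ((M.augmented L).toHistoryPolicy m)).map records =
        ∫ ω, f (records ω) ∂M.law ((M.augmented L).toHistoryPolicy m) :=
    integral_map measurable_records.aemeasurable hf.aestronglyMeasurable
  refine eq_processLaw _ _ _ (fun g => ?_) fun n g => ?_
  · refine (hmap (measurable_info 0 fun _ u => g (PUnit.unit, u 0))).trans ?_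
    refine (M.integral_law_zero L _ fun u _ => g (PUnit.unit, u)).trans ?_
    rw [PMF.mean_const]
    exact (PMF.mean_pure (α := Record Y U 0) _ _).symm
  · refine (hmap (measurable_frestrictLe (E := Record Y U) (n + 1) fun h =>
        g (fun i => h ⟨i, Finset.mem_Iic.2 ((Finset.mem_Iic.1 i.2).trans n.le_succ)⟩)
          (h ⟨n + 1, Finset.mem_Iic.2 le_rfl⟩))).trans (Eq.trans ?_
      (hmap (measurable_frestrictLe (E := Record Y U) n fun h =>
        PMF.mean (α := Record Y U (n + 1)) (((M.augmented L).obsLaw ((M.augmented L).belief n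
          (pastObs h) fun j => pastCtrl h j.castSucc) (pastCtrl h (Fin.last n))).map fun y' =>
            (y', m ((M.augmented L).filter ((M.augmented L).belief n
              (pastObs h) fun j => pastCtrl h j.castSucc) (pastCtrl h (Fin.last n)) y')))
          (g h))).symm)
    change ∫ ω, g (Preorder.frestrictLe n (records ω)) (records ω (n + 1)) ∂M.law _ = _
    simp only [← recordsOfHist_obsHist_ctrlHist]
    refine (M.integral_obs_succ L _ n fun y u y' u' => g (recordsOfHist y u) (y', u')).trans ?_
    refine integral_congr_ae (.of_forall fun ω => ?_)
    simp only [POMDP.toHistoryPolicy, POMDP.belief_snoc]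
    rw [recordsOfHist_obsHist_ctrlHist]
    exact (PMF.mean_map (α := Y) (β := Record Y U (n + 1)) _ _ _).symm

end ISCPOMDP

/-! ### Expected costs and dynamic programming -/

namespace POMDP

variable {S U Y : Type*} [Fintype S] [Finite U] (Q : POMDP S U Y)

theorem exists_cost_bound : ∃ B, ∀ s u, |Q.cost s u| ≤ B := by
  obtain ⟨B, hB⟩ := (Set.finite_range fun z : S × U => |Q.cost z.1 z.2|).bddAbove
  exact ⟨B, fun s u => hB ⟨(s, u), rfl⟩⟩

variable [Finite Y]

instance (m : Q.BeliefPolicy) : IsProbabilityMeasure (Q.law m) := by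
  unfold law
  infer_instance

theorem measurable_beliefCost (k : ℕ) :
    Measurable fun r : ∀ k, Record Y U k => Q.beliefCost (Q.beliefAt r k) (ctrlAt r k) :=
  measurable_info k fun y u => Q.beliefCost (Q.belief k y fun j => u j.castSucc) (u (Fin.last k))

theorem summable_integrable_costTerm (m : Q.BeliefPolicy) :
    (∀ r, Summable (Q.costTerm r)) ∧ Integrable (fun r => ∑' k, Q.costTerm r k) (Q.law m) := by
  obtain ⟨B, hB⟩ := Q.exists_cost_bound
  have h := integral_discounted_tsum (Q.law m) Q.γ_pos Q.γ_lt_one _ Q.measurable_beliefCost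
    fun _ _ => Q.abs_beliefCost_le hB _ _
  exact ⟨h.1, h.2.1⟩

end POMDP

namespace ISCPOMDP

variable {X U Y S : Type*} [Finite X] [Finite U] [Finite Y] (M : ISCPOMDP X U Y)
  (L : X × X ≃ S) (μ : HistoryPolicy Y U)

theorem costTerm_eq (hψ : ∀ ξ u, M.ψ ξ u = 0) (ω : ∀ k, Stage X Y U k) (k : ℕ) :
    M.costTerm μ ω k =
      M.γ ^ k * (M.augmented L).cost (augState L ω k) (ctrlAt (records ω) k) := by
  simp [costTerm, hψ, augmented]

theorem measurable_cost (k : ℕ) : Measurable fun ω : ∀ k, Stage X Y U k =>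
    (M.augmented L).cost (augState L ω k) (ctrlAt (records ω) k) :=
  measurable_stages L k fun _ u s _ => (M.augmented L).cost s (u (Fin.last k).castSucc)

variable [Fintype S]

theorem summable_integrable_costTerm (hψ : ∀ ξ u, M.ψ ξ u = 0) :
    (∀ ω, Summable (M.costTerm μ ω)) ∧ Integrable (fun ω => ∑' k, M.costTerm μ ω k) (M.law μ) := by
  cases nonempty_fintype X
  obtain ⟨B, hB⟩ := (M.augmented (.refl _)).exists_cost_bound
  have h := integral_discounted_tsum (M.law μ) M.γ_pos M.γ_lt_one _ (M.measurable_cost (.refl _))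
    fun _ _ => hB _ _
  have hc : M.costTerm μ = fun ω k => M.γ ^ k * (M.augmented (.refl _)).cost
      (augState (.refl _) ω k) (ctrlAt (records ω) k) :=
    funext fun ω => funext fun k => M.costTerm_eq (.refl _) μ hψ ω k
  rw [hc]
  exact ⟨h.1, h.2.1⟩

/-- By the filtering theorem the expected stage costs are expected linear belief costs. -/
theorem expectedCost_eq_tsum (hψ : ∀ ξ u, M.ψ ξ u = 0) :
    M.expectedCost μ = ∑' k, M.γ ^ k * ∫ ω, (M.augmented L).beliefCost
      ((M.augmented L).beliefAt (records ω) k) (ctrlAt (records ω) k) ∂M.law μ := by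
  obtain ⟨B, hB⟩ := (M.augmented L).exists_cost_bound
  simp only [expectedCost, M.costTerm_eq L μ hψ]
  rw [(integral_discounted_tsum (M.law μ) M.γ_pos M.γ_lt_one _ (M.measurable_cost L)
    fun _ _ => hB _ _).2.2]
  refine tsum_congr fun k => congrArg _ ?_
  refine (M.integral_eq_integral_mean_belief L μ k fun _ u s =>
    (M.augmented L).cost s (u (Fin.last k))).trans ?_
  exact integral_congr_ae (.of_forall fun ω => PMF.mean_eq_sum _ _)

theorem expectedCost_eq_integral_belief (hψ : ∀ ξ u, M.ψ ξ u = 0) :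
    M.expectedCost μ = ∫ ω, ∑' k, (M.augmented L).costTerm (records ω) k ∂M.law μ := by
  obtain ⟨B, hB⟩ := (M.augmented L).exists_cost_bound
  rw [M.expectedCost_eq_tsum L μ hψ]
  exact (integral_discounted_tsum (M.law μ) M.γ_pos M.γ_lt_one _
    (fun k => ((M.augmented L).measurable_beliefCost k).comp measurable_records)
    fun _ _ => (M.augmented L).abs_beliefCost_le hB _ _).2.2.symm

theorem expectedCost_eq_integral_posterior (hψ : ∀ ξ u, M.ψ ξ u = 0) :
    M.expectedCost μ = ∫ ω, ∑' k, M.γ ^ k * (M.augmented L).beliefCost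
      ((M.posteriorAt μ ω k).map L) (ctrlAt (records ω) k) ∂M.law μ := by
  rw [M.expectedCost_eq_integral_belief L μ hψ]
  refine integral_congr_ae ?_
  filter_upwards [M.ae_posteriorAt_map_eq_beliefAt L μ] with ω hω
  simp only [hω]
  rfl

theorem expectedCost_toHistoryPolicy (hψ : ∀ ξ u, M.ψ ξ u = 0) (m : (M.augmented L).BeliefPolicy) :
    M.expectedCost ((M.augmented L).toHistoryPolicy m) = (M.augmented L).expectedCost m := by
  rw [M.expectedCost_eq_integral_belief L _ hψ, POMDP.expectedCost, ← map_records_law]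
  refine (integral_map (f := fun r => ∑' k, (M.augmented L).costTerm r k)
    measurable_records.aemeasurable ?_).symm
  rw [map_records_law]
  exact ((M.augmented L).summable_integrable_costTerm m).2.aestronglyMeasurable

/-- The expected cost of a policy is `V` at the initial belief plus the discounted expected Bellman
defects of `V` along the policy. -/
theorem expectedCost_eq_add_defects (hψ : ∀ ξ u, M.ψ ξ u = 0) (V : PMF S → ℝ) {B : ℝ}
    (hV : ∀ ξ, |V ξ| ≤ B) :
    M.expectedCost μ = V (M.augmented L).init + ∑' k, M.γ ^ k *
      ∫ ω, ((M.augmented L).beliefCost ((M.augmented L).beliefAt (records ω) k)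
          (ctrlAt (records ω) k) +
        M.γ * ((M.augmented L).obsLaw ((M.augmented L).beliefAt (records ω) k)
          (ctrlAt (records ω) k)).mean (fun y => V ((M.augmented L).filter
            ((M.augmented L).beliefAt (records ω) k) (ctrlAt (records ω) k) y)) -
        V ((M.augmented L).beliefAt (records ω) k)) ∂M.law μ := by
  obtain ⟨B', hB'⟩ := (M.augmented L).exists_cost_bound
  have hbound (f : (∀ k, Stage X Y U k) → ℝ) (C : ℝ) (hf : ∀ ω, |f ω| ≤ C) :
      |∫ ω, f ω ∂M.law μ| ≤ C := by
    simpa using norm_integral_le_of_norm_le_const (μ := M.law μ) (f := f) (.of_forall hf)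
  have hint (k : ℕ) (f : (Fin k → Y) → (Fin (k + 1) → U) → ℝ) :
      Integrable (fun ω => f (obsHist (records ω) k) (ctrlHist (records ω) (k + 1))) (M.law μ) :=
    integrable_frestrictLe (E := Stage X Y U) (M.law μ) k fun h =>
      f (pastObs fun i => (h i).2) (pastCtrl fun i => (h i).2)
  rw [M.expectedCost_eq_tsum L μ hψ, discounted_tsum_eq_add_defects M.γ_pos M.γ_lt_one
    (fun k => ∫ ω, V ((M.augmented L).beliefAt (records ω) k) ∂M.law μ) _ (B := max B B')
    (fun k => hbound _ _ fun ω => (hV _).trans (le_max_left _ _))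
    (fun k => hbound _ _ fun ω => ((M.augmented L).abs_beliefCost_le hB' _ _).trans
      (le_max_right _ _))]
  congr 1
  · simp [POMDP.beliefAt, POMDP.belief]
  · refine tsum_congr fun k => congrArg _ ?_
    have h1 : ∫ ω, V ((M.augmented L).beliefAt (records ω) (k + 1)) ∂M.law μ =
        ∫ ω, ((M.augmented L).obsLaw ((M.augmented L).beliefAt (records ω) k)
          (ctrlAt (records ω) k)).mean (fun y => V ((M.augmented L).filter
            ((M.augmented L).beliefAt (records ω) k) (ctrlAt (records ω) k) y)) ∂M.law μ := by
      simp only [POMDP.beliefAt, obsHist_succ, POMDP.belief_snoc]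
      exact M.integral_obs_succ L μ k fun y u y' _ => V ((M.augmented L).filter
        ((M.augmented L).belief k y fun j => u j.castSucc) (u (Fin.last k)) y')
    have hV' := hint k fun y u => V ((M.augmented L).belief k y fun j => u j.castSucc)
    have hC := hint k fun y u => (M.augmented L).beliefCost
      ((M.augmented L).belief k y fun j => u j.castSucc) (u (Fin.last k))
    have hT := (hint k fun y u => ((M.augmented L).obsLaw
      ((M.augmented L).belief k y fun j => u j.castSucc) (u (Fin.last k))).mean
        fun y' => V ((M.augmented L).filter ((M.augmented L).belief k y fun j => u j.castSucc)
          (u (Fin.last k)) y')).const_mul M.γ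
    rw [h1, ← integral_const_mul]
    refine Eq.trans ?_ (integral_sub (hC.add hT) hV').symm
    exact congrArg (· - _) (integral_add hC hT).symm

/-- Dynamic programming: the belief policy that minimizes the right-hand side of the Bellman
equation is optimal among all history-dependent policies. -/
theorem exists_beliefPolicy_expectedCost_le [Nonempty U] (hψ : ∀ ξ u, M.ψ ξ u = 0) :
    ∃ m : (M.augmented L).BeliefPolicy, ∀ μ : HistoryPolicy Y U,
      M.expectedCost ((M.augmented L).toHistoryPolicy m) ≤ M.expectedCost μ := by
  obtain ⟨B, hB⟩ := (M.augmented L).exists_cost_bound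
  obtain ⟨V, m, ⟨B', hB'⟩, hle, heq⟩ := exists_bellman_solution M.γ_pos M.γ_lt_one
    (M.augmented L).beliefCost ((M.augmented L).abs_beliefCost_le hB) (M.augmented L).obsLaw
    (M.augmented L).filter
  refine ⟨m, fun μ => ?_⟩
  rw [M.expectedCost_eq_add_defects L _ hψ V hB', M.expectedCost_eq_add_defects L μ hψ V hB']
  refine add_le_add le_rfl ?_
  -- The defects vanish along `m` and are nonnegative along every policy.
  have h0 (k : ℕ) : ∫ ω, ((M.augmented L).beliefCost ((M.augmented L).beliefAt (records ω) k)
          (ctrlAt (records ω) k) +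
        M.γ * ((M.augmented L).obsLaw ((M.augmented L).beliefAt (records ω) k)
          (ctrlAt (records ω) k)).mean (fun y => V ((M.augmented L).filter
            ((M.augmented L).beliefAt (records ω) k) (ctrlAt (records ω) k) y)) -
        V ((M.augmented L).beliefAt (records ω) k))
        ∂M.law ((M.augmented L).toHistoryPolicy m) = 0 := by
    refine integral_eq_zero_of_ae ?_
    filter_upwards [M.ae_ctrlAt_eq ((M.augmented L).toHistoryPolicy m) k] with ω hω
    have h1 : ctrlAt (records ω) k = m ((M.augmented L).beliefAt (records ω) k) := hω
    rw [h1, ← heq, sub_self]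
    rfl
  simp only [h0, mul_zero, tsum_zero]
  exact tsum_nonneg fun k => mul_nonneg (pow_pos M.γ_pos k).le
    (integral_nonneg fun ω => sub_nonneg.2 (hle _ _))

end ISCPOMDP

end

theorem corollary1 {X U Y S : Type*} [Finite X] [Finite U] [Nonempty U] [Finite Y] [Fintype S]
    (M : ISCPOMDP X U Y) (L : X × X ≃ S) (hψ : ∀ ξ u, M.ψ ξ u = 0) :
    -- `S_k = L (X_0, X_k)` has the augmented initial, transition and measurement probabilities
    (∀ (μ : HistoryPolicy Y U) (s : S),
      M.law μ {ω | L (stateAt ω 0, stateAt ω 0) = s} = (M.augmented L).init s) ∧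
    (∀ (μ : HistoryPolicy Y U) (k : ℕ) (s s' : S) (u : U),
      M.law μ {ω | L (stateAt ω 0, stateAt ω k) = s ∧ ctrlAt (records ω) k = u} ≠ 0 →
      ProbabilityTheory.cond (M.law μ)
          {ω | L (stateAt ω 0, stateAt ω k) = s ∧ ctrlAt (records ω) k = u}
          {ω | L (stateAt ω 0, stateAt ω (k + 1)) = s'} =
        (M.augmented L).trans u s s') ∧
    (∀ (μ : HistoryPolicy Y U) (k : ℕ) (s : S) (u : U) (y : Y),
      M.law μ {ω | L (stateAt ω 0, stateAt ω (k + 1)) = s ∧ ctrlAt (records ω) k = u} ≠ 0 →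
      ProbabilityTheory.cond (M.law μ)
          {ω | L (stateAt ω 0, stateAt ω (k + 1)) = s ∧ ctrlAt (records ω) k = u}
          {ω | obsSucc (records ω) k = y} =
        (M.augmented L).obs u s y) ∧
    -- under every policy the posterior `ξ_k` is the belief of the augmented POMDP, and the next
    -- measurement has the law `p(y | ξ_k, u_k)`
    (∀ μ : HistoryPolicy Y U, ∀ᵐ ω ∂(M.law μ), ∀ k,
      (M.posteriorAt μ ω k).map L = (M.augmented L).beliefAt (records ω) k) ∧
    (∀ (μ : HistoryPolicy Y U) (k : ℕ) (y : Fin k → Y) (u : Fin k → U) (v : U) (y' : Y),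
      M.law μ {ω | ω ∈ infoEvent k y u ∧ ctrlAt (records ω) k = v} ≠ 0 →
      ProbabilityTheory.cond (M.law μ) {ω | ω ∈ infoEvent k y u ∧ ctrlAt (records ω) k = v}
          {ω | obsSucc (records ω) k = y'} =
        (M.augmented L).obsLaw ((M.posterior μ k y u).map L) v y') ∧
    -- all expected costs are well defined
    (∀ (μ : HistoryPolicy Y U),
      (∀ ω, Summable (M.costTerm μ ω)) ∧
      MeasureTheory.Integrable (fun ω => ∑' k, M.costTerm μ ω k) (M.law μ)) ∧
    (∀ m : (M.augmented L).BeliefPolicy,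
      (∀ r, Summable ((M.augmented L).costTerm r)) ∧
      MeasureTheory.Integrable (fun r => ∑' k, (M.augmented L).costTerm r k)
        ((M.augmented L).law m)) ∧
    -- under every policy the ISC cost is the expected discounted linear belief cost
    (∀ μ : HistoryPolicy Y U,
      M.expectedCost μ =
        ∫ ω, ∑' k, M.γ ^ k * (M.augmented L).beliefCost ((M.posteriorAt μ ω k).map L)
          (ctrlAt (records ω) k) ∂(M.law μ)) ∧
    -- a belief policy induces the same law of measurements and controls, and the same cost, in
    -- both problems
    (∀ m : (M.augmented L).BeliefPolicy,
      (M.law ((M.augmented L).toHistoryPolicy m)).map records = (M.augmented L).law m ∧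
      M.expectedCost ((M.augmented L).toHistoryPolicy m) = (M.augmented L).expectedCost m) ∧
    -- the two optimization problems have the same value, and solutions of the augmented POMDP
    -- exist and are solutions of the ISC-POMDP
    M.value = (M.augmented L).value ∧
    (∃ m : (M.augmented L).BeliefPolicy, (M.augmented L).IsOptimal m) ∧
    (∀ m : (M.augmented L).BeliefPolicy,
      (M.augmented L).IsOptimal m ↔ M.IsOptimal ((M.augmented L).toHistoryPolicy m)) := by

  obtain ⟨m₀, hm₀⟩ := M.exists_beliefPolicy_expectedCost_le L hψ
  have hQ (m : (M.augmented L).BeliefPolicy) := M.expectedCost_toHistoryPolicy L hψ m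
  have hopt : (M.augmented L).IsOptimal m₀ := fun m => by
    rw [← hQ, ← hQ]
    exact hm₀ _
  refine ⟨M.law_augState_zero L, M.cond_augState_succ L, M.cond_obsSucc_augState L,
    M.ae_posteriorAt_map_eq_beliefAt L, M.cond_obsSucc_infoEvent L,
    fun μ => M.summable_integrable_costTerm μ hψ, (M.augmented L).summable_integrable_costTerm,
    fun μ => M.expectedCost_eq_integral_posterior L μ hψ,
    fun m => ⟨M.map_records_law L m, hQ m⟩, ?_, ⟨m₀, hopt⟩,
    fun m => ⟨fun h μ => ?_, fun h m' => ?_⟩⟩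
  · have h1 : M.value = M.expectedCost ((M.augmented L).toHistoryPolicy m₀) :=
      IsLeast.csInf_eq ⟨⟨_, rfl⟩, Set.forall_mem_range.2 hm₀⟩
    have h2 : (M.augmented L).value = (M.augmented L).expectedCost m₀ :=
      IsLeast.csInf_eq ⟨⟨_, rfl⟩, Set.forall_mem_range.2 hopt⟩
    rw [h1, h2, hQ]
  · rw [hQ]
    exact (h m₀).trans ((hQ m₀).symm.trans_le (hm₀ μ))
  · rw [← hQ, ← hQ]
    exact h _
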